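/- **Setting.** Let $A\in\mathbb R^{m\times n}$, $b\in\mathbb R^m$, $\Omega=\{x\in\mathbb R^n: Ax\le b\}\ne\emptyset$, let $f:\mathbb R^n\to\mathbb R$ be continuously differentiable with gradient $g$, and consider the problem (P): $\min\{f(x):x\in\Omega\}$. Let $\mathcal P_S$ denote Euclidean projection onto $S$, and write $\mathcal A(x)=\{i:(Ax)_i=b_i\}$, $\mathcal F(x)=\{i:(Ax)_i<b_i\}$, $\Omega(x)=\{y\in\Omega:(Ay)_i=b_i\ \forall i\in\mathcal A(x)\}$. Let $g^{\mathcal A}(x)$ be the orthogonal projection of $g(x)$ onto $\{v:(Av)_i=0\ \forall i\in\mathcal A(x)\}$. Put $y(x,\alpha)=\mathcal P_\Omega(x-\alpha g(x))$, $d^\alpha(x)=y(x,\alpha)-x$, $e(x)=\|g^{\mathcal A}(x)\|$ and $E(x)=\|d^1(x)\|$. Let $\lambda(x)$ denote any multiplier of the projection problem defining $y=y(x,1)$, that is, any $\lambda\ge 0$ with $y-x+g(x)+A^{\sf T}\lambda=0$ and $\lambda_i=0$ for $i\in\mathcal F(y)$, and let $\mathcal U(x)=\{i:\lambda_i(x)\ge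 E(x)^\gamma,\ (b-Ax)_i\ge E(x)^\beta\}$. **The algorithm (PASA).** The parameters are $\delta,\eta,\gamma,\mu\in(0,1)$, $\alpha\in(0,\infty)$, $\beta\in(1,2)$, an initial $\theta\in(0,1)$, and a tolerance $\epsilon\ge0$. Start from $x_1=\mathcal P_\Omega(x_0)$, in phase one, and stop as soon as $E(x_k)\le\epsilon$. *Phase one.* At each iterate $x_k$ in phase one, including the iterate at which phase one is entered: if $\mathcal U(x_k)=\emptyset$ and $e(x_k)<\theta E(x_k)$, then replace $\theta$ by $\mu\theta$. After this, if $e(x_k)\ge\theta E(x_k)$, go to phase two; otherwise set $x_{k+1}=x_k+\eta^j d^\alpha(x_k)$, where $j\ge0$ is the smallest integer with $f(x_k+\eta^j d^\alpha(x_k))\le f(x_k)+\eta^j\delta\, g(x_k)^{\sf T}d^\alpha(x_k)$. *Phase two.* Iterate with a linearly constrained optimizer (LCO), and go to phase one as soon as $e(x_k)<\theta E(x_k)$. The LCO satisfies: - (F1) $x_k\in\Omega$ and $f(x_{k+1})\le f(x_k)$. - (F2) $\mathcal A(x_k)\subset\mathcal A(x_{k+1})$. - (F3) If from some iteration on only the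 LCO is run and $\mathcal A(x_{j+1})=\mathcal A(x_j)$, then $\liminf_{j\to\infty} e(x_j)=0$. - (F4) The first iteration after a branch from phase one is $x_{k+1}=\mathcal P_{\Omega(x_k)}(x_k-\alpha\eta^j g^{\mathcal A}(x_k))$, with $j\ge0$ the smallest integer for which $f(x_{k+1})\le f(x_k)+\delta\, g(x_k)^{\sf T}(x_{k+1}-x_k)$. **Theorem.** Suppose that PASA with $\epsilon=0$ generates an infinite sequence of iterates converging to a local minimizer $x^*$ of (P), that the rows of $A$ with index in $\mathcal A(x^*)$ are linearly independent, and that $f$ is twice continuously differentiable in a neighborhood of $x^*$. Let $\mathcal A_+(x^*)=\{i\in\mathcal A(x^*):\lambda^*_i>0\}$, where $\lambda^*$ is the (unique) vector with $g(x^*)+A^{\sf T}\lambda^*=0$, $\lambda^*\ge0$, and $\lambda^*_i=0$ for $i\in\mathcal F(x^*)$. Suppose further that the strong second-order sufficient optimality condition holds at $x^*$: there is $\sigma>0$ such that $v^{\sf T}\nabla^2 f(x^*)v\ge\sigma\|v\|^2$ whenever $(Av)_i=0$ for all $i\in\mathcal A_+(x^*)$. Then within a finite number of iterations only phase two is executed: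 there is $K$ such that for every $k\ge K$ phase one is not executed at $x_k$, and $x_{k+1}$ is generated by the LCO. -/

import Mathlib

open Filter Topology

namespace PASA

/-- The metric projection of `u` onto `S`: a point of `S` nearest to `u` (the unique one when `S` is
nonempty, closed and convex, see `metricProj_spec` and `metricProj_unique`). -/
noncomputable def metricProj {n : ℕ} (S : Set (EuclideanSpace ℝ (Fin n)))
    (u : EuclideanSpace ℝ (Fin n)) : EuclideanSpace ℝ (Fin n) :=
  Classical.epsilon fun p => p ∈ S ∧ ∀ y ∈ S, ‖u - p‖ ≤ ‖u - y‖

theorem metricProj_spec {n : ℕ} {S : Set (EuclideanSpace ℝ (Fin n))} (hne : S.Nonempty)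
    (hcl : IsClosed S) (u : EuclideanSpace ℝ (Fin n)) :
    metricProj S u ∈ S ∧ ∀ y ∈ S, ‖u - metricProj S u‖ ≤ ‖u - y‖ := by
  obtain ⟨p, hp, h⟩ := hcl.exists_infDist_eq_dist hne u
  refine Classical.epsilon_spec
    (p := fun p => p ∈ S ∧ ∀ y ∈ S, ‖u - p‖ ≤ ‖u - y‖) ⟨p, hp, fun y hy => ?_⟩
  rw [← dist_eq_norm, ← dist_eq_norm, ← h]
  exact Metric.infDist_le_dist_of_mem hy

theorem metricProj_unique {n : ℕ} {S : Set (EuclideanSpace ℝ (Fin n))} (hcl : IsClosed S)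
    (hcv : Convex ℝ S) {u p : EuclideanSpace ℝ (Fin n)} (hp : p ∈ S)
    (h : ∀ y ∈ S, ‖u - p‖ ≤ ‖u - y‖) : metricProj S u = p := by
  obtain ⟨hq, h'⟩ := metricProj_spec ⟨p, hp⟩ hcl u
  set q := metricProj S u
  have he : ‖u - p‖ = ‖u - q‖ := le_antisymm (h q hq) (h' p hp)
  have hm : (1 / 2 : ℝ) • p + (1 / 2 : ℝ) • q ∈ S :=
    hcv hp hq (by norm_num) (by norm_num) (by norm_num)
  have h1 := h _ hm
  have hpar := parallelogram_law_with_norm ℝ (u - p) (u - q)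
  have e1 : (u - p) + (u - q) = (2 : ℝ) • (u - ((1 / 2 : ℝ) • p + (1 / 2 : ℝ) • q)) := by
    module
  have e2 : (u - p) - (u - q) = q - p := by abel
  rw [e1, e2, norm_smul, ← he] at hpar
  have h2 : ‖(2 : ℝ)‖ = 2 := by norm_num
  rw [h2] at hpar
  have h3 : ‖q - p‖ = 0 := by
    nlinarith [norm_nonneg (u - p), norm_nonneg (q - p)]
  exact sub_eq_zero.mp (norm_eq_zero.mp h3)

/-- The data `A`, `b`, `f` of the problem `min f(x)` subject to `A x ≤ b`, with `f : ℝⁿ → ℝ` and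
`A` an `m × n` matrix. -/
structure Problem (m n : ℕ) where
  A : Matrix (Fin m) (Fin n) ℝ
  b : Fin m → ℝ
  f : EuclideanSpace ℝ (Fin n) → ℝ

namespace Problem

variable {m n : ℕ} (P : Problem m n)

/-- The vector `A x`. -/
def mulA (x : EuclideanSpace ℝ (Fin n)) : Fin m → ℝ := P.A.mulVec x.ofLp

/-- The vector `Aᵀ lam`. -/
def mulAT (lam : Fin m → ℝ) : EuclideanSpace ℝ (Fin n) :=
  WithLp.toLp 2 (P.A.transpose.mulVec lam)

/-- The feasible polyhedron `Ω = {x : A x ≤ b}`. -/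
def feasible : Set (EuclideanSpace ℝ (Fin n)) := {x | ∀ i, P.mulA x i ≤ P.b i}

/-- The active set at `x`. -/
def active (x : EuclideanSpace ℝ (Fin n)) : Set (Fin m) := {i | P.mulA x i = P.b i}

/-- The free set at `x`. -/
def free (x : EuclideanSpace ℝ (Fin n)) : Set (Fin m) := {i | P.mulA x i < P.b i}

/-- The face of `Ω` consisting of the feasible points at which all constraints active at `x` are
active. -/
def face (x : EuclideanSpace ℝ (Fin n)) : Set (EuclideanSpace ℝ (Fin n)) :=
  {y | y ∈ P.feasible ∧ ∀ i ∈ P.active x, P.mulA y i = P.b i}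

/-- The gradient of the objective, as a column vector. -/
noncomputable def g (x : EuclideanSpace ℝ (Fin n)) : EuclideanSpace ℝ (Fin n) := gradient P.f x

/-- The null space of the submatrix `A_I` of the rows of `A` with index in `I`. -/
def nullSpace (I : Set (Fin m)) : Submodule ℝ (EuclideanSpace ℝ (Fin n)) where
  carrier := {y | ∀ i ∈ I, P.mulA y i = 0}
  add_mem' := by
    intro a b ha hb i hi
    have h1 := ha i hi
    have h2 := hb i hi
    simp only [mulA] at h1 h2 ⊢
    simp [Matrix.mulVec_add, h1, h2]
  zero_mem' := by
    intro i _
    simp [mulA]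
  smul_mem' := by
    intro c a ha i hi
    have h1 := ha i hi
    simp only [mulA] at h1 ⊢
    simp [Matrix.mulVec_smul, h1]

/-- The orthogonal projection of the gradient at `x` onto the null space of the active rows. -/
noncomputable def gA (x : EuclideanSpace ℝ (Fin n)) : EuclideanSpace ℝ (Fin n) :=
  (P.nullSpace (P.active x)).starProjection (P.g x)

/-- The local stationarity measure `e`. -/
noncomputable def e (x : EuclideanSpace ℝ (Fin n)) : ℝ := ‖P.gA x‖

/-- The projected gradient step `y(x, α) = P_Ω (x - α g(x))`. -/
noncomputable def y (x : EuclideanSpace ℝ (Fin n)) (α : ℝ) : EuclideanSpace ℝ (Fin n) :=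
  metricProj P.feasible (x - α • P.g x)

/-- The direction `d^α(x) = y(x, α) - x`. -/
noncomputable def d (x : EuclideanSpace ℝ (Fin n)) (α : ℝ) : EuclideanSpace ℝ (Fin n) :=
  P.y x α - x

/-- The global stationarity measure `E(x) = ‖d¹(x)‖`. -/
noncomputable def E (x : EuclideanSpace ℝ (Fin n)) : ℝ := ‖P.d x 1‖

/-- The Lagrange multipliers of the projection problem `min ½‖x - α g(x) - y‖²` subject to
`A y ≤ b`, at its solution `y(x, α)`. -/
def projMultipliers (x : EuclideanSpace ℝ (Fin n)) (α : ℝ) : Set (Fin m → ℝ) :=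
  {lam | P.y x α - x + α • P.g x + P.mulAT lam = 0 ∧ (∀ i, 0 ≤ lam i) ∧
    ∀ i ∈ P.free (P.y x α), lam i = 0}

/-- The Lagrange multipliers of the problem `min f` over `Ω` at the point `x`. -/
def multipliers (x : EuclideanSpace ℝ (Fin n)) : Set (Fin m → ℝ) :=
  {lam | P.g x + P.mulAT lam = 0 ∧ (∀ i, 0 ≤ lam i) ∧ ∀ i ∈ P.free x, lam i = 0}

/-- The active indices at `x` with a positive Lagrange multiplier. (The multiplier is unique when
the active constraint gradients are linearly independent.) -/
def activePlus (x : EuclideanSpace ℝ (Fin n)) : Set (Fin m) :=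
  {i | i ∈ P.active x ∧ ∃ lam ∈ P.multipliers x, 0 < lam i}

/-- The rows of `A` with index active at `x` form a linearly independent family. -/
def LinIndepActive (x : EuclideanSpace ℝ (Fin n)) : Prop :=
  LinearIndependent ℝ (fun i : P.active x => P.A i.1)

/-- The strong second-order sufficient optimality condition at `x`: there is `σ > 0` with
`dᵀ ∇²f(x) d ≥ σ ‖d‖²` whenever `(A d)_i = 0` for all `i` in `activePlus x`. -/
def StrongSecondOrder (x : EuclideanSpace ℝ (Fin n)) : Prop :=
  ∃ σ : ℝ, 0 < σ ∧ ∀ v : EuclideanSpace ℝ (Fin n),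
    (∀ i ∈ P.activePlus x, P.mulA v i = 0) →
      σ * ‖v‖ ^ 2 ≤ inner ℝ v (fderiv ℝ P.g x v)

end Problem

/-- The parameters of the algorithm: `δ`, `η`, `α` of the line searches, `β`, `γ` of the undecided
index set, the decay factor `μ` and the initial value `θ₁` of `θ`. -/
structure Params where
  δ : ℝ
  η : ℝ
  α : ℝ
  β : ℝ
  γ : ℝ
  μ : ℝ
  θ₁ : ℝ
  δ_mem : δ ∈ Set.Ioo (0 : ℝ) 1
  η_mem : η ∈ Set.Ioo (0 : ℝ) 1
  α_pos : 0 < α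
  β_mem : β ∈ Set.Ioo (1 : ℝ) 2
  γ_mem : γ ∈ Set.Ioo (0 : ℝ) 1
  μ_mem : μ ∈ Set.Ioo (0 : ℝ) 1
  θ₁_mem : θ₁ ∈ Set.Ioo (0 : ℝ) 1

variable {m n : ℕ}

/-- The undecided index set at `x`, computed from the multiplier vector `lam`. -/
def undecided (P : Problem m n) (par : Params) (x : EuclideanSpace ℝ (Fin n))
    (lam : Fin m → ℝ) : Set (Fin m) :=
  {i | P.E x ^ par.γ ≤ lam i ∧ P.E x ^ par.β ≤ P.b i - P.mulA x i}

/-- `x'` is produced from `x` by one iteration of the gradient projection algorithm. -/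
def GPAStep (P : Problem m n) (par : Params) (x x' : EuclideanSpace ℝ (Fin n)) : Prop :=
  ∃ j : ℕ,
    IsLeast {j : ℕ | P.f (x + par.η ^ j • P.d x par.α) ≤
      P.f x + par.η ^ j * par.δ * inner ℝ (P.g x) (P.d x par.α)} j ∧
    x' = x + par.η ^ j • P.d x par.α

/-- The point reached from `x` by a projected step of length `s` in the face of `x`. -/
noncomputable def facePoint (P : Problem m n) (x : EuclideanSpace ℝ (Fin n)) (s : ℝ) :
    EuclideanSpace ℝ (Fin n) :=
  metricProj (P.face x) (x - s • P.gA x)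

/-- `x'` is produced from `x` by the Armijo line search in the face of `x`; this is the first
iteration of phase two after a branch from phase one (requirement F4 on the linearly constrained
optimizer). -/
def StartStep (P : Problem m n) (par : Params) (x x' : EuclideanSpace ℝ (Fin n)) : Prop :=
  ∃ j : ℕ,
    IsLeast {j : ℕ | P.f (facePoint P x (par.α * par.η ^ j)) ≤
      P.f x + par.δ * inner ℝ (P.g x) (facePoint P x (par.α * par.η ^ j) - x)} j ∧
    x' = facePoint P x (par.α * par.η ^ j)

/-- The per-iteration requirements F1 and F2 on an iteration `x ↦ x'` of the linearly constrained
optimizer: feasibility, monotone objective, no active constraint is freed. -/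
def LCOStep (P : Problem m n) (x x' : EuclideanSpace ℝ (Fin n)) : Prop :=
  x ∈ P.feasible ∧ x' ∈ P.feasible ∧ P.f x' ≤ P.f x ∧ P.active x ⊆ P.active x'

inductive Phase
  | one
  | two

/-- A state of the algorithm: the current iterate, the current value of `θ`, and the phase whose
iteration led to this iterate (phase one at the start). -/
structure State (n : ℕ) where
  x : EuclideanSpace ℝ (Fin n)
  θ : ℝ
  phase : Phase

/-- Phase one is executed at the current iterate: either the algorithm is already in phase one, or
it is in phase two and the test `e(x) < θ E(x)` sends it back to phase one. -/
def State.ExecutesPhaseOne (P : Problem m n) (s : State n) : Prop :=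
  s.phase = Phase.one ∨ P.e s.x < s.θ * P.E s.x

open Classical in
/-- The value of `θ` after the update of phase one: `θ` is multiplied by `μ` if the undecided index
set is empty and `e(x) < θ E(x)`. -/
noncomputable def State.updatedTheta (P : Problem m n) (par : Params) (s : State n)
    (lam : Fin m → ℝ) : ℝ :=
  if undecided P par s.x lam = ∅ ∧ P.e s.x < s.θ * P.E s.x then par.μ * s.θ else s.θ

/-- One iteration of the polyhedral active set algorithm (from one iterate to the next), where `lam`
is the multiplier vector used in the undecided index set at the current iterate.

While phase one is executed, the update of `θ` and the branching test are applied to the current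
iterate (in particular to the iterate at which phase one is entered) before a gradient projection
step is taken from it. -/
inductive Step (P : Problem m n) (par : Params) (lam : Fin m → ℝ) : State n → State n → Prop
  | gpa (s : State n) (x' : EuclideanSpace ℝ (Fin n))
      (h1 : s.ExecutesPhaseOne P)
      (h2 : P.e s.x < s.updatedTheta P par lam * P.E s.x)
      (h3 : GPAStep P par s.x x') :
      Step P par lam s ⟨x', s.updatedTheta P par lam, Phase.one⟩
  | branch (s : State n) (x' : EuclideanSpace ℝ (Fin n))
      (h1 : s.ExecutesPhaseOne P)
      (h2 : s.updatedTheta P par lam * P.E s.x ≤ P.e s.x)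
      (h3 : StartStep P par s.x x') :
      Step P par lam s ⟨x', s.updatedTheta P par lam, Phase.two⟩
  | lco (s : State n) (x' : EuclideanSpace ℝ (Fin n))
      (h1 : ¬ s.ExecutesPhaseOne P)
      (h2 : LCOStep P s.x x') :
      Step P par lam s ⟨x', s.θ, Phase.two⟩

/-- `s 1, s 2, s 3, …` is an infinite run of the polyhedral active set algorithm with convergence
tolerance `ε` and starting guess `x₀`; the value `s 0` plays no role. -/
structure IsInfiniteRun (P : Problem m n) (par : Params) (ε : ℝ)
    (x₀ : EuclideanSpace ℝ (Fin n)) (s : ℕ → State n) : Prop where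
  start : s 1 = ⟨metricProj P.feasible x₀, par.θ₁, Phase.one⟩
  /-- The stopping criterion `E(x_k) ≤ ε` is never met. -/
  not_stopped : ∀ k ≥ 1, ε < P.E (s k).x
  /-- Each iteration is one of the algorithm, with some choice of the Lagrange multiplier that
  defines the undecided index set. -/
  step : ∀ k ≥ 1, ∃ lam ∈ P.projMultipliers (s k).x 1, Step P par lam (s k) (s (k + 1))
  /-- Requirement F3 on the linearly constrained optimizer: if from some iteration on only the
  optimizer is run and the active set no longer changes, then `liminf e(x_j) = 0`. -/
  lco_liminf : ∀ K ≥ 1,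
    (∀ k ≥ K, ¬ (s k).ExecutesPhaseOne P ∧ P.active (s (k + 1)).x = P.active (s k).x) →
    liminf (fun k => ((P.e (s k).x : ℝ) : EReal)) atTop = 0

end PASA

namespace PASA

open scoped RealInnerProductSpace

/-! Everything rests on a local error bound: strong second-order sufficiency gives `‖x - xs‖ ≤ c * E
x` near the limit (`IsDual.exists_norm_sub_le_E`). Linear independence supplies vectors dual to the
active rows, so that multipliers become continuous functions of `d x 1 + g x`. Together these facts
sort the projection multipliers: those of strongly active constraints stay away from zero, hence
exceed `E ^ γ`, while all others are `O(E)`, hence below `E ^ γ`. So undecided indices are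
eventually strongly active, and an empty undecided set means that every strongly active constraint
has slack below `E ^ β`.

Two estimates then cover every late iterate at which `e < θ E`. If the undecided set is empty, the
slacks are `o(E)` and `IsDual.exists_mul_E_le_e` gives `c E ≤ e` with a fixed `c > 0`. Thus `θ`
exceeds `c` just when it is multiplied by `μ`, which can happen only finitely often. If the
undecided set is nonempty, a gradient projection step is taken. A slack of order `E ^ β` with `β <
2` makes the first-order decrease dominate the `O(E ^ 2)` errors, so the full step is accepted
(`IsDual.eventually_armijo`) and lands on a point where all strongly active constraints are active.
This persists, and the undecided set is empty from then on.

Hence `e < θ E` holds only finitely often; once it stops holding, the next step leads to phase two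
and phase one is never executed again. -/

/-- The variational inequality characterizing the metric projection onto a closed convex set. -/
theorem metricProj_inner_le {n : ℕ} {S : Set (EuclideanSpace ℝ (Fin n))} (hne : S.Nonempty)
    (hcl : IsClosed S) (hcv : Convex ℝ S) (u : EuclideanSpace ℝ (Fin n)) :
    ∀ z ∈ S, ⟪u - metricProj S u, z - metricProj S u⟫ ≤ 0 := by
  obtain ⟨hp, h⟩ := metricProj_spec hne hcl u
  rw [← norm_eq_iInf_iff_real_inner_le_zero hcv hp]
  have : Nonempty S := hne.to_subtype
  refine le_antisymm (le_ciInf fun w => h w w.2) ?_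
  exact ciInf_le ⟨0, by rintro _ ⟨w, rfl⟩; exact norm_nonneg _⟩ (⟨_, hp⟩ : S)

/-- Near zero, a multiple of the higher of two real powers is below the lower one. -/
theorem eventually_mul_rpow_lt (c : ℝ) {p q : ℝ} (hpq : p < q) :
    ∀ᶠ t : ℝ in 𝓝 0, 0 < t → c * t ^ q < t ^ p := by
  have h : Tendsto (fun t : ℝ => c * t ^ (q - p)) (𝓝 0) (𝓝 0) := by
    have := (Real.continuousAt_rpow_const 0 (q - p) (Or.inr (sub_nonneg.2 hpq.le))).tendsto
    rw [Real.zero_rpow (sub_pos.2 hpq).ne'] at this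
    simpa using this.const_mul c
  filter_upwards [h.eventually_lt_const one_pos] with t ht h0
  have e : t ^ q = t ^ (q - p) * t ^ p := by rw [← Real.rpow_add h0]; ring_nf
  rw [e, ← mul_assoc]
  exact mul_lt_of_lt_one_left (Real.rpow_pos_of_pos h0 p) ht

namespace Problem

variable {m n : ℕ} (P : Problem m n)

/-! ### Constraint map, polyhedron and faces. -/

theorem mulA_eq_inner (x : EuclideanSpace ℝ (Fin n)) (i : Fin m) :
    P.mulA x i = ⟪WithLp.toLp 2 (P.A i), x⟫ := by
  simp [mulA, Matrix.mulVec, dotProduct, PiLp.inner_apply, mul_comm]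

theorem mulA_add (x z : EuclideanSpace ℝ (Fin n)) (i : Fin m) :
    P.mulA (x + z) i = P.mulA x i + P.mulA z i := by
  simp only [mulA_eq_inner, inner_add_right]

theorem mulA_sub (x z : EuclideanSpace ℝ (Fin n)) (i : Fin m) :
    P.mulA (x - z) i = P.mulA x i - P.mulA z i := by
  simp only [mulA_eq_inner, inner_sub_right]

theorem mulA_smul (c : ℝ) (x : EuclideanSpace ℝ (Fin n)) (i : Fin m) :
    P.mulA (c • x) i = c * P.mulA x i := by
  simp only [mulA_eq_inner, real_inner_smul_right]

theorem continuous_mulA (i : Fin m) : Continuous fun x => P.mulA x i := by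
  simp only [mulA_eq_inner]
  fun_prop

theorem inner_mulAT (lam : Fin m → ℝ) (x : EuclideanSpace ℝ (Fin n)) :
    ⟪P.mulAT lam, x⟫ = ∑ i, lam i * P.mulA x i := by
  have h : P.mulAT lam = ∑ i, lam i • WithLp.toLp 2 (P.A i) := by
    ext j
    simp [mulAT, Matrix.mulVec, dotProduct, mul_comm]
  simp [h, sum_inner, real_inner_smul_left, mulA_eq_inner]

theorem isClosed_feasible : IsClosed P.feasible := by
  simp only [feasible, Set.ofPred_forall]
  exact isClosed_iInter fun i => isClosed_le (P.continuous_mulA i) continuous_const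

theorem convex_feasible : Convex ℝ P.feasible := by
  intro x hx z hz a c ha hc hac i
  rw [mulA_add, mulA_smul, mulA_smul]
  have h1 := mul_le_mul_of_nonneg_left (hx i) ha
  have h2 := mul_le_mul_of_nonneg_left (hz i) hc
  have h3 : P.b i = a * P.b i + c * P.b i := by rw [← add_mul, hac, one_mul]
  linarith

theorem isClosed_face (x : EuclideanSpace ℝ (Fin n)) : IsClosed (P.face x) := by
  have h : P.face x = P.feasible ∩ ⋂ i ∈ P.active x, {z | P.mulA z i = P.b i} := by
    ext z
    simp [face]
  rw [h]
  exact P.isClosed_feasible.inter <| isClosed_biInter fun i _ =>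
    isClosed_eq (P.continuous_mulA i) continuous_const

theorem self_mem_face {x : EuclideanSpace ℝ (Fin n)} (hx : x ∈ P.feasible) : x ∈ P.face x :=
  ⟨hx, fun _ hi => hi⟩

variable {P} {xs : EuclideanSpace ℝ (Fin n)}

theorem active_subset_eventually (hxs : xs ∈ P.feasible) :
    ∀ᶠ x in 𝓝 xs, ∀ i ∉ P.active xs, P.mulA x i < P.b i := by
  rw [eventually_all]
  intro i
  by_cases hi : i ∈ P.active xs
  · exact Eventually.of_forall fun x h => absurd hi h
  · have h := (P.continuous_mulA i).tendsto xs
    filter_upwards [h.eventually_lt_const (lt_of_le_of_ne (hxs i) hi)] with x hx _ using hx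

theorem y_mem (hne : P.feasible.Nonempty) (x : EuclideanSpace ℝ (Fin n)) (α : ℝ) :
    P.y x α ∈ P.feasible :=
  (metricProj_spec hne P.isClosed_feasible _).1

theorem y_inner_le {z : EuclideanSpace ℝ (Fin n)} (hz : z ∈ P.feasible)
    (x : EuclideanSpace ℝ (Fin n)) (α : ℝ) :
    ⟪x - α • P.g x - P.y x α, z - P.y x α⟫ ≤ 0 :=
  metricProj_inner_le ⟨z, hz⟩ P.isClosed_feasible P.convex_feasible _ z hz

/-! ### Dual vectors, stationarity and local smoothness. -/

/-- Linear independence of the active rows gives vectors dual to them. -/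
theorem LinIndepActive.exists_dual (h : P.LinIndepActive xs) :
    ∃ v : Fin m → EuclideanSpace ℝ (Fin n), ∀ i ∈ P.active xs, ∀ j ∈ P.active xs,
      P.mulA (v i) j = if j = i then 1 else 0 := by
  have key : ∀ i : P.active xs, ∃ w : EuclideanSpace ℝ (Fin n), ∀ j ∈ P.active xs,
      P.mulA w j = if j = i then 1 else 0 := by
    intro i
    -- The coordinate functional of row `i` on the span of the active rows extends to the whole
    -- space; the vector representing the extension is the dual vector.
    obtain ⟨φ, hφ⟩ := LinearMap.exists_extend ((Finsupp.lapply i).comp h.repr)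
    refine ⟨WithLp.toLp 2 fun k => φ (Pi.single k 1), fun j hj => ?_⟩
    have h1 : φ (P.A j) = P.mulA (WithLp.toLp 2 fun k => φ (Pi.single k 1)) j := by
      conv_lhs => rw [LinearMap.pi_apply_eq_sum_univ φ (P.A j)]
      simp only [mulA, Matrix.mulVec, dotProduct, smul_eq_mul]
      refine Finset.sum_congr rfl fun k _ => ?_
      congr 2
      ext l
      simp [Pi.single_apply, eq_comm]
    have hmem : P.A j ∈ Submodule.span ℝ (Set.range fun i : P.active xs => P.A i.1) :=
      Submodule.subset_span ⟨⟨j, hj⟩, rfl⟩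
    have h2 := LinearMap.congr_fun hφ ⟨_, hmem⟩
    have h3 : h.repr ⟨_, hmem⟩ = Finsupp.single ⟨j, hj⟩ 1 :=
      h.repr_eq_single ⟨j, hj⟩ _ rfl
    simp only [LinearMap.comp_apply, h3, Submodule.subtype_apply, Finsupp.lapply_apply,
      Finsupp.single_apply] at h2
    rw [← h1, h2]
    simp [Subtype.ext_iff]
  choose w hw using key
  classical
  refine ⟨fun i => if hi : i ∈ P.active xs then w ⟨i, hi⟩ else 0, fun i hi j hj => ?_⟩
  simp [hi, hw ⟨i, hi⟩ j hj]

/-- A local minimizer over the polyhedron is a stationary point. -/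
theorem inner_nonneg_of_isLocalMinOn (hf : DifferentiableAt ℝ P.f xs) (hxs : xs ∈ P.feasible)
    (hmin : IsLocalMinOn P.f P.feasible xs) :
    ∀ z ∈ P.feasible, 0 ≤ ⟪P.g xs, z - xs⟫ := by
  intro z hz
  have hc : z - xs ∈ posTangentConeAt P.feasible xs := by
    refine mem_posTangentConeAt_of_segment_subset ?_
    rw [add_sub_cancel]
    exact P.convex_feasible.segment_subset hxs hz
  have := hmin.hasFDerivWithinAt_nonneg hf.hasFDerivAt.hasFDerivWithinAt hc
  rwa [← inner_gradient_left] at this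

/-- The gradient of a `C²` function is `C¹`. -/
theorem contDiffAt_g (h : ContDiffAt ℝ 2 P.f xs) : ContDiffAt ℝ 1 P.g xs := by
  have h1 : ContDiffAt ℝ 1 (fderiv ℝ P.f) xs := h.fderiv_right (by norm_num)
  rw [contDiffAt_euclidean]
  intro i
  have e : (fun x => (P.g x).ofLp i) = fun x => fderiv ℝ P.f x (EuclideanSpace.single i 1) := by
    ext x
    rw [← inner_gradient_left, EuclideanSpace.inner_single_right]
    simp [g]
  rw [e]
  exact h1.clm_apply contDiffAt_const

theorem exists_lipschitz_g (h : ContDiffAt ℝ 1 P.g xs) :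
    ∃ L > 0, ∃ r > 0, ∀ u ∈ Metric.ball xs r, ∀ w ∈ Metric.ball xs r,
      ‖P.g u - P.g w‖ ≤ L * ‖u - w‖ := by
  obtain ⟨K, s, hs, hK⟩ := (h.hasStrictFDerivAt one_ne_zero).exists_lipschitzOnWith
  obtain ⟨r, hr, hrs⟩ := Metric.mem_nhds_iff.1 hs
  refine ⟨K + 1, by positivity, r, hr, fun u hu w hw => ?_⟩
  have := hK.norm_sub_le (hrs hu) (hrs hw)
  nlinarith [norm_nonneg (u - w)]

/-- A quadratic bound on the error of the first-order expansion of the objective. -/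
theorem taylor_bound (hf : Differentiable ℝ P.f) {L r : ℝ} (hL : 0 < L)
    (h : ∀ u ∈ Metric.ball xs r, ∀ w ∈ Metric.ball xs r, ‖P.g u - P.g w‖ ≤ L * ‖u - w‖)
    {u w : EuclideanSpace ℝ (Fin n)} (hu : u ∈ Metric.ball xs r) (hw : w ∈ Metric.ball xs r) :
    P.f w ≤ P.f u + ⟪P.g u, w - u⟫ + L * ‖w - u‖ ^ 2 := by
  have hseg : segment ℝ u w ⊆ Metric.ball xs r := (convex_ball xs r).segment_subset hu hw
  have := (convex_segment u w).norm_image_sub_le_of_norm_hasFDerivWithin_le'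
    (f := P.f) (f' := fderiv ℝ P.f) (φ := fderiv ℝ P.f u) (C := L * ‖w - u‖)
    (fun z _ => (hf z).hasFDerivAt.hasFDerivWithinAt) (fun z hz => ?_)
    (left_mem_segment ℝ u w) (right_mem_segment ℝ u w)
  · rw [← inner_gradient_left, Real.norm_eq_abs] at this
    have h2 := (abs_le.1 this).2
    change P.f w - P.f u - ⟪P.g u, w - u⟫ ≤ _ at h2
    nlinarith
  · rw [← toDual_gradient, ← toDual_gradient, ← map_sub, LinearIsometryEquiv.norm_map]
    refine (h z (hseg hz) u hu).trans (mul_le_mul_of_nonneg_left ?_ hL.le)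
    exact norm_sub_le_of_mem_segment hz

/-- The second-order condition makes the gradient strongly monotone at `xs` along the directions
annihilated by the strongly active rows. -/
theorem StrongSecondOrder.exists_monotone (hs : P.StrongSecondOrder xs)
    (h : ContDiffAt ℝ 1 P.g xs) :
    ∃ σ > 0, ∀ᶠ u in 𝓝 xs, (∀ i ∈ P.activePlus xs, P.mulA (u - xs) i = 0) →
      σ * ‖u - xs‖ ^ 2 ≤ ⟪P.g u - P.g xs, u - xs⟫ := by
  obtain ⟨σ, hσ, H⟩ := hs
  -- Half of the curvature pays for the remainder in linearizing the gradient at `xs`.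
  refine ⟨σ / 2, half_pos hσ, ?_⟩
  have hd := (h.differentiableAt one_ne_zero).hasFDerivAt.isLittleO
  filter_upwards [hd.bound (half_pos hσ)] with u hu hi
  have h1 := H _ hi
  have h2 := (abs_le.1 (abs_real_inner_le_norm
    (P.g u - P.g xs - fderiv ℝ P.g xs (u - xs)) (u - xs))).1
  rw [inner_sub_left, real_inner_comm (u - xs) (fderiv ℝ P.g xs (u - xs))] at h2
  rw [real_inner_comm] at h1
  rw [real_inner_comm] at h2
  nlinarith [norm_nonneg (u - xs), mul_le_mul_of_nonneg_right hu (norm_nonneg (u - xs)),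
    real_inner_comm (u - xs) (fderiv ℝ P.g xs (u - xs)),
    real_inner_comm (u - xs) (P.g u - P.g xs)]

/-! ### Projected gradient steps near a stationary point. -/

/-- Near a stationary point the projected gradient step is Lipschitz at that point. -/
theorem exists_norm_y_sub_le (hxs : xs ∈ P.feasible)
    (hst : ∀ z ∈ P.feasible, 0 ≤ ⟪P.g xs, z - xs⟫) (hg : ContDiffAt ℝ 1 P.g xs)
    {α : ℝ} (hα : 0 < α) :
    ∃ C > 0, ∀ᶠ x in 𝓝 xs, ‖P.y x α - xs‖ ≤ C * ‖x - xs‖ := by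
  obtain ⟨L, hL, r, hr, hlip⟩ := exists_lipschitz_g hg
  refine ⟨1 + α * L, by positivity, ?_⟩
  filter_upwards [Metric.ball_mem_nhds xs hr] with x hx
  have h1 := P.y_inner_le hxs x α
  have h2 := mul_nonneg hα.le (hst _ (P.y_mem ⟨xs, hxs⟩ x α))
  have h3 := hlip x hx xs (Metric.mem_ball_self hr)
  set q := P.y x α - xs with hq
  -- The variational inequality of the projection, tested at `xs`, is combined with stationarity of
  -- `xs`, tested at `y x α`; the term in `g xs` then has the right sign to be dropped.
  have h4 : ‖q‖ ^ 2 ≤ ⟪(x - xs) - α • (P.g x - P.g xs), q⟫ := by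
    have e1 : x - α • P.g x - P.y x α =
      (x - xs) - α • (P.g x - P.g xs) - α • P.g xs - q := by rw [hq]; module
    have e2 : xs - P.y x α = -q := by rw [hq]; abel
    rw [e1, e2, inner_neg_right, inner_sub_left, inner_sub_left, real_inner_smul_left,
      real_inner_self_eq_norm_sq] at h1
    linarith
  have h5 : ‖(x - xs) - α • (P.g x - P.g xs)‖ ≤ (1 + α * L) * ‖x - xs‖ := by
    refine (norm_sub_le _ _).trans ?_
    rw [norm_smul, Real.norm_of_nonneg hα.le]
    nlinarith
  have h6 := (real_inner_le_norm ((x - xs) - α • (P.g x - P.g xs)) q)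
  rcases (norm_nonneg q).eq_or_lt with h0 | h0
  · rw [← h0]; positivity
  · refine le_of_mul_le_mul_right ?_ h0
    nlinarith [mul_le_mul_of_nonneg_right h5 h0.le]

theorem tendsto_y (hxs : xs ∈ P.feasible)
    (hst : ∀ z ∈ P.feasible, 0 ≤ ⟪P.g xs, z - xs⟫) (hg : ContDiffAt ℝ 1 P.g xs)
    {α : ℝ} (hα : 0 < α) : Tendsto (fun x => P.y x α) (𝓝 xs) (𝓝 xs) := by
  obtain ⟨C, -, hC⟩ := exists_norm_y_sub_le hxs hst hg hα
  rw [tendsto_iff_norm_sub_tendsto_zero]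
  refine squeeze_zero' (Eventually.of_forall fun _ => norm_nonneg _) hC ?_
  have : Tendsto (fun x => C * ‖x - xs‖) (𝓝 xs) (𝓝 (C * ‖xs - xs‖)) :=
    Continuous.tendsto (by fun_prop) xs
  simpa using this

theorem exists_E_le (hxs : xs ∈ P.feasible)
    (hst : ∀ z ∈ P.feasible, 0 ≤ ⟪P.g xs, z - xs⟫) (hg : ContDiffAt ℝ 1 P.g xs) :
    ∃ C > 0, ∀ᶠ x in 𝓝 xs, P.E x ≤ C * ‖x - xs‖ := by
  obtain ⟨C, h0, hC⟩ := exists_norm_y_sub_le hxs hst hg one_pos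
  refine ⟨C + 1, by positivity, ?_⟩
  filter_upwards [hC] with x hx
  have e : P.d x 1 = (P.y x 1 - xs) - (x - xs) := by rw [d]; abel
  rw [E, e]
  linarith [norm_sub_le (P.y x 1 - xs) (x - xs)]

theorem E_nonneg (x : EuclideanSpace ℝ (Fin n)) : 0 ≤ P.E x := norm_nonneg _

theorem tendsto_E (hxs : xs ∈ P.feasible)
    (hst : ∀ z ∈ P.feasible, 0 ≤ ⟪P.g xs, z - xs⟫) (hg : ContDiffAt ℝ 1 P.g xs) :
    Tendsto P.E (𝓝 xs) (𝓝 0) := by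
  obtain ⟨C, -, hC⟩ := exists_E_le hxs hst hg
  refine squeeze_zero' (Eventually.of_forall E_nonneg) hC ?_
  have : Tendsto (fun x => C * ‖x - xs‖) (𝓝 xs) (𝓝 (C * ‖xs - xs‖)) :=
    Continuous.tendsto (by fun_prop) xs
  simpa using this

/-! ### Multipliers read off from dual vectors. -/

/-- `v i`, for `i` active at `xs`, is dual to the active rows. -/
def IsDual (P : Problem m n) (xs : EuclideanSpace ℝ (Fin n))
    (v : Fin m → EuclideanSpace ℝ (Fin n)) : Prop :=
  ∀ i ∈ P.active xs, ∀ j ∈ P.active xs, P.mulA (v i) j = if j = i then 1 else 0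

variable {v : Fin m → EuclideanSpace ℝ (Fin n)}

theorem IsDual.inner_mulAT (hv : P.IsDual xs v) {lam : Fin m → ℝ}
    (h : ∀ i ∉ P.active xs, lam i = 0) {i : Fin m} (hi : i ∈ P.active xs) :
    ⟪P.mulAT lam, v i⟫ = lam i := by
  rw [P.inner_mulAT, Finset.sum_eq_single i]
  · simp [hv i hi i hi]
  · intro j _ hj
    by_cases hja : j ∈ P.active xs
    · simp [hv i hi j hja, hj]
    · simp [h j hja]
  · simp

/-- Pairing the stationarity equation with `v i` isolates one coefficient. The right-hand side does
not involve `lam`, so the multiplier is unique. -/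
theorem IsDual.multiplier_eq (hv : P.IsDual xs v) (hxs : xs ∈ P.feasible) {lam : Fin m → ℝ}
    (h : lam ∈ P.multipliers xs) {i : Fin m} (hi : i ∈ P.active xs) :
    lam i = -⟪P.g xs, v i⟫ := by
  rw [← hv.inner_mulAT (fun j hj => h.2.2 j (lt_of_le_of_ne (hxs j) hj)) hi, ← inner_neg_left,
    eq_neg_of_add_eq_zero_right h.1]

/-- Near `xs`, a multiplier of the projection problem is supported on the rows active at `xs` and
is read off from the dual vectors. -/
theorem IsDual.eventually_projMultiplier_eq (hv : P.IsDual xs v) (hxs : xs ∈ P.feasible)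
    (hst : ∀ z ∈ P.feasible, 0 ≤ ⟪P.g xs, z - xs⟫) (hg : ContDiffAt ℝ 1 P.g xs) :
    ∀ᶠ x in 𝓝 xs, ∀ lam ∈ P.projMultipliers x 1, (∀ i ∉ P.active xs, lam i = 0) ∧
      ∀ i ∈ P.active xs, lam i = -⟪P.d x 1 + P.g x, v i⟫ := by
  filter_upwards [(tendsto_y hxs hst hg one_pos).eventually (active_subset_eventually hxs)]
    with x hx lam hlam
  have h0 : ∀ i ∉ P.active xs, lam i = 0 := fun i hi => hlam.2.2 i (hx i hi)
  refine ⟨h0, fun i hi => ?_⟩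
  have h1 := hlam.1
  rw [one_smul] at h1
  rw [← hv.inner_mulAT h0 hi, ← inner_neg_left, eq_neg_of_add_eq_zero_right h1, d]

/-- Projection multipliers are linear in `d x 1 + g x`, so this limit carries them to the multiplier
at `xs`. -/
theorem tendsto_d_add_g (hxs : xs ∈ P.feasible)
    (hst : ∀ z ∈ P.feasible, 0 ≤ ⟪P.g xs, z - xs⟫) (hg : ContDiffAt ℝ 1 P.g xs) :
    Tendsto (fun x => P.d x 1 + P.g x) (𝓝 xs) (𝓝 (P.g xs)) := by
  have h := ((tendsto_y hxs hst hg one_pos).sub (tendsto_id (x := 𝓝 xs))).add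
    hg.continuousAt.tendsto
  simpa [d] using h

/-- A multiplier at `xs` arises as a limit of projection multipliers at nearby points: the explicit
formula `Λ` is continuous, and both the stationarity equation and nonnegativity are closed
conditions. -/
theorem IsDual.multipliers_nonempty (hv : P.IsDual xs v) (hxs : xs ∈ P.feasible)
    (hst : ∀ z ∈ P.feasible, 0 ≤ ⟪P.g xs, z - xs⟫) (hg : ContDiffAt ℝ 1 P.g xs)
    (h : ∃ᶠ x in 𝓝 xs, (P.projMultipliers x 1).Nonempty) : (P.multipliers xs).Nonempty := by
  classical
  let Λ : EuclideanSpace ℝ (Fin n) → Fin m → ℝ := fun u i =>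
    if i ∈ P.active xs then -⟪u, v i⟫ else 0
  have hΛ : Continuous Λ := by
    refine continuous_pi fun i => ?_
    by_cases hi : i ∈ P.active xs
    · simp only [Λ, hi, if_true]; fun_prop
    · simp only [Λ, hi, if_false]; fun_prop
  have hAT : Continuous P.mulAT := by
    unfold mulAT
    fun_prop
  have ht := tendsto_d_add_g hxs hst hg
  have hfr : ∃ᶠ x in 𝓝 xs, P.d x 1 + P.g x + P.mulAT (Λ (P.d x 1 + P.g x)) = 0 ∧
      ∀ i, 0 ≤ Λ (P.d x 1 + P.g x) i := by
    refine (h.and_eventually (hv.eventually_projMultiplier_eq hxs hst hg)).mono ?_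
    rintro x ⟨⟨lam, hlam⟩, hx⟩
    have e : Λ (P.d x 1 + P.g x) = lam := by
      ext i
      by_cases hi : i ∈ P.active xs
      · simp only [Λ, hi, if_true, (hx lam hlam).2 i hi]
      · simp only [Λ, hi, if_false, (hx lam hlam).1 i hi]
    rw [e]
    have h1 := hlam.1
    rw [one_smul] at h1
    exact ⟨h1, hlam.2.1⟩
  refine ⟨Λ (P.g xs), ?_, fun i => ?_, fun i hi => ?_⟩
  · have hc : Continuous fun u => u + P.mulAT (Λ u) := continuous_id.add (hAT.comp hΛ)
    exact isClosed_singleton.mem_of_frequently_of_tendsto (hfr.mono fun x hx => hx.1)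
      ((hc.tendsto _).comp ht)
  · exact ge_of_tendsto_of_frequently
      ((((continuous_apply i).comp hΛ).tendsto _).comp ht) (hfr.mono fun x hx => hx.2 i)
  · have : i ∉ P.active xs := (ne_of_lt hi)
    simp [Λ, this]

theorem inner_g_eq_neg_sum {lam : Fin m → ℝ}
    (h : lam ∈ P.multipliers xs) (w : EuclideanSpace ℝ (Fin n)) :
    ⟪P.g xs, w⟫ = -∑ i, lam i * P.mulA w i := by
  rw [← P.inner_mulAT, eq_neg_of_add_eq_zero_left h.1, inner_neg_left]

/-- By uniqueness, the existential in `activePlus` can be tested on any given multiplier. -/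
theorem IsDual.activePlus_iff (hv : P.IsDual xs v) (hxs : xs ∈ P.feasible) {lam : Fin m → ℝ}
    (h : lam ∈ P.multipliers xs) {i : Fin m} : i ∈ P.activePlus xs ↔ 0 < lam i := by
  constructor
  · rintro ⟨hi, lam', h', hpos⟩
    rwa [hv.multiplier_eq hxs h hi, ← hv.multiplier_eq hxs h' hi]
  · intro hpos
    refine ⟨?_, lam, h, hpos⟩
    by_contra hi
    exact hpos.ne' (h.2.2 i (lt_of_le_of_ne (hxs i) hi))

theorem IsDual.inner_g_eq_zero (hv : P.IsDual xs v) (hxs : xs ∈ P.feasible)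
    (hm : (P.multipliers xs).Nonempty) {w : EuclideanSpace ℝ (Fin n)}
    (hw : ∀ i ∈ P.activePlus xs, P.mulA w i = 0) : ⟪P.g xs, w⟫ = 0 := by
  obtain ⟨lam, h⟩ := hm
  rw [inner_g_eq_neg_sum h, neg_eq_zero]
  refine Finset.sum_eq_zero fun i _ => ?_
  by_cases hi : i ∈ P.activePlus xs
  · rw [hw i hi, mul_zero]
  · rw [hv.activePlus_iff hxs h, not_lt] at hi
    rw [le_antisymm hi (h.2.1 i), zero_mul]

/-- Near `xs` the strongly active constraints are active at the projected gradient point. -/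
theorem IsDual.eventually_activePlus_subset_y (hv : P.IsDual xs v) (hxs : xs ∈ P.feasible)
    (hst : ∀ z ∈ P.feasible, 0 ≤ ⟪P.g xs, z - xs⟫) (hg : ContDiffAt ℝ 1 P.g xs)
    {α : ℝ} (hα : 0 < α) :
    ∀ᶠ x in 𝓝 xs, P.activePlus xs ⊆ P.active (P.y x α) := by
  have hy := tendsto_y hxs hst hg hα
  suffices ∀ i, ∀ᶠ x in 𝓝 xs, i ∈ P.activePlus xs → i ∈ P.active (P.y x α) from
    eventually_all.2 this
  intro i
  by_cases hi : i ∈ P.activePlus xs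
  swap
  · exact Eventually.of_forall fun x h => absurd h hi
  have hia := hi.1
  obtain ⟨-, lam, hlam, hpos⟩ := hi
  -- The residual of the projection, paired with `v i`, tends to `α * lam i > 0`, so `v i` cannot be
  -- a feasible direction at the projected point.
  have hlim : Tendsto (fun x => ⟪x - α • P.g x - P.y x α, v i⟫) (𝓝 xs) (𝓝 (α * lam i)) := by
    have h1 : Tendsto (fun x => x - α • P.g x - P.y x α) (𝓝 xs) (𝓝 (xs - α • P.g xs - xs)) :=
      ((tendsto_id (x := 𝓝 xs)).sub (hg.continuousAt.tendsto.const_smul α)).sub hy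
    have h2 := Filter.Tendsto.inner (𝕜 := ℝ) h1 (tendsto_const_nhds (x := v i))
    rw [sub_sub_cancel_left, inner_neg_left, real_inner_smul_left, ← mul_neg,
      ← hv.multiplier_eq hxs hlam hia] at h2
    exact h2
  filter_upwards [hlim.eventually_const_lt (mul_pos hα hpos),
    hy.eventually (active_subset_eventually hxs)] with x hx hfree _
  by_contra hna
  -- If row `i` were inactive at `y x α`, a short move along `v i` would stay feasible: among the
  -- rows active at `xs` it changes only row `i`, and all remaining rows have slack.
  have hslack : ∀ j, ∃ ε > 0, ∀ t : ℝ, 0 < t → t ≤ ε → P.mulA (P.y x α + t • v i) j ≤ P.b j := by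
    intro j
    have hf := P.y_mem ⟨xs, hxs⟩ x α
    have strict : P.mulA (P.y x α) j < P.b j →
        ∃ ε > 0, ∀ t : ℝ, 0 < t → t ≤ ε → P.mulA (P.y x α + t • v i) j ≤ P.b j := by
      intro hlt
      refine ⟨(P.b j - P.mulA (P.y x α) j) / (|P.mulA (v i) j| + 1),
        div_pos (sub_pos.2 hlt) (by positivity), fun t ht hte => ?_⟩
      rw [le_div_iff₀ (by positivity)] at hte
      rw [mulA_add, mulA_smul]
      nlinarith [le_abs_self (P.mulA (v i) j)]
    by_cases hj : j ∈ P.active xs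
    · by_cases hji : j = i
      · exact strict (hji ▸ lt_of_le_of_ne (hf i) hna)
      · refine ⟨1, one_pos, fun t _ _ => ?_⟩
        rw [mulA_add, mulA_smul, hv i hia j hj, if_neg hji]
        simpa using hf j
    · exact strict (hfree j hj)
  choose ε hε hle using hslack
  obtain ⟨t, ht, hte⟩ : ∃ t > 0, ∀ j, t ≤ ε j := by
    have h0 : ∀ᶠ t in 𝓝[>] (0 : ℝ), ∀ j, t ≤ ε j :=
      (eventually_all.2 fun j => eventually_le_nhds (hε j)).filter_mono nhdsWithin_le_nhds
    obtain ⟨t, ht⟩ := (h0.and self_mem_nhdsWithin).exists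
    exact ⟨t, ht.2, ht.1⟩
  have h1 := P.y_inner_le (z := P.y x α + t • v i) (fun j => hle j t ht (hte j)) x α
  rw [add_sub_cancel_left, real_inner_smul_right] at h1
  nlinarith

theorem mulA_sub_eq_zero {u w : EuclideanSpace ℝ (Fin n)} {i : Fin m} (hu : i ∈ P.active u)
    (hw : i ∈ P.active w) : P.mulA (u - w) i = 0 := by
  have h1 : P.mulA u i = P.b i := hu
  have h2 : P.mulA w i = P.b i := hw
  rw [mulA_sub, h1, h2, sub_self]

/-! ### Error bound, multiplier sizes and the two stationarity measures. -/

/-- Near `xs` the distance to `xs` is bounded by a multiple of the stationarity measure `E`. -/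
theorem IsDual.exists_norm_sub_le_E (hv : P.IsDual xs v) (hxs : xs ∈ P.feasible)
    (hst : ∀ z ∈ P.feasible, 0 ≤ ⟪P.g xs, z - xs⟫) (hg : ContDiffAt ℝ 1 P.g xs)
    (hs : P.StrongSecondOrder xs) :
    ∃ c > 0, ∀ᶠ x in 𝓝 xs, ‖x - xs‖ ≤ c * P.E x := by
  obtain ⟨σ, hσ, hmono⟩ := hs.exists_monotone hg
  obtain ⟨L, hL, r, hr, hlip⟩ := exists_lipschitz_g hg
  have hy := tendsto_y hxs hst hg one_pos
  refine ⟨(L + 1) / σ + 1, by positivity, ?_⟩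
  filter_upwards [hy.eventually hmono, hv.eventually_activePlus_subset_y hxs hst hg one_pos,
    Metric.ball_mem_nhds xs hr, hy.eventually_mem (Metric.ball_mem_nhds xs hr)] with x h1 h2 hx hyx
  -- Monotonicity is applied at `y x 1` rather than at `x`, because the strongly active constraints
  -- are known to be active only there. The distance from `x` itself then costs one further `E x`.
  have h3 := h1 fun i hi => mulA_sub_eq_zero (h2 hi) hi.1
  have h4 := P.y_inner_le hxs x 1
  have h5 := hst _ (P.y_mem ⟨xs, hxs⟩ x 1)
  have h6 := hlip _ hyx x hx
  have e1 : P.y x 1 - x = P.d x 1 := rfl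
  rw [e1] at h6
  set q := P.y x 1 - xs with hq
  have e2 : x - (1 : ℝ) • P.g x - P.y x 1 = -(P.d x 1 + P.g x) := by rw [d]; module
  have e3 : xs - P.y x 1 = -q := by rw [hq]; abel
  rw [e2, e3, inner_neg_neg] at h4
  have h7 : σ * ‖q‖ ^ 2 ≤ ⟪P.g (P.y x 1) - P.g x - P.d x 1, q⟫ := by
    rw [inner_sub_left, inner_sub_left]
    rw [inner_add_left] at h4
    rw [inner_sub_left] at h3
    linarith
  have h8 : ‖P.g (P.y x 1) - P.g x - P.d x 1‖ ≤ (L + 1) * P.E x := by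
    refine (norm_sub_le _ _).trans ?_
    rw [add_mul, one_mul]
    exact add_le_add h6 le_rfl
  have h9 : σ * ‖q‖ ≤ (L + 1) * P.E x := by
    rcases (norm_nonneg q).eq_or_lt with h0 | h0
    · rw [← h0, mul_zero]; exact mul_nonneg (by positivity) (E_nonneg x)
    · refine le_of_mul_le_mul_right ?_ h0
      nlinarith [real_inner_le_norm (P.g (P.y x 1) - P.g x - P.d x 1) q,
        mul_le_mul_of_nonneg_right h8 h0.le]
  have h10 : ‖q‖ ≤ (L + 1) / σ * P.E x := by
    rw [div_mul_eq_mul_div, le_div_iff₀ hσ]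
    linarith
  have e4 : x - xs = q - P.d x 1 := by rw [hq, d]; abel
  rw [e4, add_mul, one_mul]
  exact (norm_sub_le _ _).trans (add_le_add h10 le_rfl)

/-- Near `xs` the projection multipliers of constraints that are not strongly active are
negligible. -/
theorem IsDual.eventually_projMultiplier_lt (hv : P.IsDual xs v) (hxs : xs ∈ P.feasible)
    (hst : ∀ z ∈ P.feasible, 0 ≤ ⟪P.g xs, z - xs⟫) (hg : ContDiffAt ℝ 1 P.g xs)
    (hs : P.StrongSecondOrder xs) (hm : (P.multipliers xs).Nonempty) {γ : ℝ} (hγ : γ < 1) :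
    ∀ᶠ x in 𝓝 xs, 0 < P.E x → ∀ lam ∈ P.projMultipliers x 1, ∀ i ∉ P.activePlus xs,
      lam i < P.E x ^ γ := by
  obtain ⟨c, hc, herr⟩ := hv.exists_norm_sub_le_E hxs hst hg hs
  obtain ⟨L, hL, r, hr, hlip⟩ := exists_lipschitz_g hg
  obtain ⟨lams, hlams⟩ := hm
  have hE := tendsto_E hxs hst hg
  have hpow : ∀ᶠ x in 𝓝 xs, ∀ i, 0 < P.E x →
      (1 + L * c) * ‖v i‖ * P.E x ^ (1 : ℝ) < P.E x ^ γ :=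
    eventually_all.2 fun i => hE.eventually (eventually_mul_rpow_lt _ hγ)
  filter_upwards [hpow, herr, Metric.ball_mem_nhds xs hr,
    hv.eventually_projMultiplier_eq hxs hst hg] with x h1 h2 hx h3 h0 lam hlam i hi
  by_cases hia : i ∈ P.active xs
  · refine lt_of_le_of_lt ?_ (h1 i h0)
    have h4 : lams i = 0 := by
      rw [hv.activePlus_iff hxs hlams, not_lt] at hi
      exact le_antisymm hi (hlams.2.1 i)
    rw [hv.multiplier_eq hxs hlams hia, neg_eq_zero] at h4
    -- The multiplier of `i` at `xs` is zero, so `g xs` can be subtracted; what remains is `O(E x)`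
    -- by the error bound.
    have h5 : lam i = ⟪-(P.d x 1 + (P.g x - P.g xs)), v i⟫ := by
      rw [(h3 lam hlam).2 i hia, inner_neg_left, inner_add_left, inner_add_left, inner_sub_left,
        h4, sub_zero]
    rw [h5, Real.rpow_one]
    refine (real_inner_le_norm _ _).trans ?_
    have h6 : ‖-(P.d x 1 + (P.g x - P.g xs))‖ ≤ (1 + L * c) * P.E x := by
      rw [norm_neg]
      refine (norm_add_le _ _).trans ?_
      have h7 := hlip x hx xs (Metric.mem_ball_self hr)
      have h8 := mul_le_mul_of_nonneg_left h2 hL.le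
      have h9 : ‖P.d x 1‖ = P.E x := rfl
      linarith
    calc _ ≤ (1 + L * c) * P.E x * ‖v i‖ := mul_le_mul_of_nonneg_right h6 (norm_nonneg _)
      _ = _ := by ring
  · rw [(h3 lam hlam).1 i hia]
    exact Real.rpow_pos_of_pos h0 γ

/-- Near `xs` the projection multipliers of strongly active constraints are not negligible. -/
theorem IsDual.eventually_le_projMultiplier (hv : P.IsDual xs v) (hxs : xs ∈ P.feasible)
    (hst : ∀ z ∈ P.feasible, 0 ≤ ⟪P.g xs, z - xs⟫) (hg : ContDiffAt ℝ 1 P.g xs)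
    {γ : ℝ} (hγ : 0 < γ) :
    ∀ᶠ x in 𝓝 xs, ∀ lam ∈ P.projMultipliers x 1, ∀ i ∈ P.activePlus xs,
      P.E x ^ γ ≤ lam i := by
  have hE : Tendsto (fun x => P.E x ^ γ) (𝓝 xs) (𝓝 0) := by
    have := (tendsto_E hxs hst hg).rpow_const (p := γ) (Or.inr hγ.le)
    rwa [Real.zero_rpow hγ.ne'] at this
  -- The multiplier tends to a positive number while `E x ^ γ` tends to zero.
  have key : ∀ i, ∀ᶠ x in 𝓝 xs, i ∈ P.activePlus xs →
      P.E x ^ γ < -⟪P.d x 1 + P.g x, v i⟫ := by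
    intro i
    by_cases hi : i ∈ P.activePlus xs
    · obtain ⟨hia, lams, hlams, hpos⟩ := hi
      have h1 := (Filter.Tendsto.inner (𝕜 := ℝ) (tendsto_d_add_g hxs hst hg)
        (tendsto_const_nhds (x := v i))).neg
      rw [← hv.multiplier_eq hxs hlams hia] at h1
      filter_upwards [hE.eventually_lt h1 hpos] with x hx _ using hx
    · exact Eventually.of_forall fun x h => absurd h hi
  filter_upwards [eventually_all.2 key, hv.eventually_projMultiplier_eq hxs hst hg]
    with x h1 h2 lam hlam i hi
  rw [(h2 lam hlam).2 i hi.1]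
  exact (h1 i hi).le

/-- The part of the gradient orthogonal to the face does not see directions in the face. -/
theorem inner_g_eq_inner_gA (x : EuclideanSpace ℝ (Fin n)) {w : EuclideanSpace ℝ (Fin n)}
    (hw : w ∈ P.nullSpace (P.active x)) : ⟪P.g x, w⟫ = ⟪P.gA x, w⟫ := by
  have h := Submodule.starProjection_inner_eq_zero (K := P.nullSpace (P.active x)) (P.g x) w hw
  rw [inner_sub_left, sub_eq_zero] at h
  exact h

/-- Near `xs` the local stationarity measure dominates the global one as soon as the strongly active
constraints are almost active. -/
theorem IsDual.exists_mul_E_le_e (hv : P.IsDual xs v) (hxs : xs ∈ P.feasible)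
    (hst : ∀ z ∈ P.feasible, 0 ≤ ⟪P.g xs, z - xs⟫) (hg : ContDiffAt ℝ 1 P.g xs)
    (hs : P.StrongSecondOrder xs) (hm : (P.multipliers xs).Nonempty) {β : ℝ} (hβ : 1 < β) :
    ∃ θ > 0, ∀ᶠ x in 𝓝 xs, x ∈ P.feasible →
      (∀ i ∈ P.activePlus xs, P.b i - P.mulA x i ≤ P.E x ^ β) → θ * P.E x ≤ P.e x := by
  classical
  obtain ⟨σ, hσ, hmono⟩ := hs.exists_monotone hg
  obtain ⟨L, hL, r, hr, hlip⟩ := exists_lipschitz_g hg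
  obtain ⟨C, hC, hEle⟩ := exists_E_le hxs hst hg
  -- The shift `w x` closes the slack of every strongly active constraint and leaves the other rows
  -- active at `xs` unchanged; under the slack hypothesis its norm is `O(E x ^ β)`.
  let t : EuclideanSpace ℝ (Fin n) → Fin m → ℝ := fun x i =>
    if i ∈ P.activePlus xs then P.b i - P.mulA x i else 0
  let w : EuclideanSpace ℝ (Fin n) → EuclideanSpace ℝ (Fin n) := fun x => ∑ i, t x i • v i
  set M := ∑ i, ‖v i‖ with hM
  have ht : ∀ i, Continuous fun x => t x i := by
    intro i
    by_cases hi : i ∈ P.activePlus xs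
    · simp only [t, hi, if_true]
      exact continuous_const.sub (P.continuous_mulA i)
    · simp only [t, hi, if_false]
      exact continuous_const
  have ht0 : ∀ i, t xs i = 0 := by
    intro i
    by_cases hi : i ∈ P.activePlus xs
    · simp only [t, hi, if_true]
      exact sub_eq_zero.2 (Eq.symm hi.1)
    · simp only [t, hi, if_false]
  have hw : Tendsto (fun x => x + w x) (𝓝 xs) (𝓝 xs) := by
    have h1 : Continuous fun x => x + w x :=
      continuous_id.add (continuous_finsetSum _ fun i _ => (ht i).smul continuous_const)
    have h2 := h1.tendsto xs
    have h3 : w xs = 0 := Finset.sum_eq_zero fun i _ => by rw [ht0 i, zero_smul]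
    rwa [h3, add_zero] at h2
  have hAw : ∀ x, ∀ j ∈ P.active xs, P.mulA (w x) j = t x j := by
    intro x j hj
    simp only [w, mulA_eq_inner, inner_sum, real_inner_smul_right]
    simp only [← mulA_eq_inner]
    rw [Finset.sum_eq_single j]
    · rw [hv j hj j hj, if_pos rfl, mul_one]
    · intro i _ hij
      by_cases hi : i ∈ P.activePlus xs
      · rw [hv i hi.1 j hj, if_neg hij.symm, mul_zero]
      · simp only [t, hi, if_false, zero_mul]
    · simp
  -- The constant is chosen so that the contribution of the shift uses up less than half of `σ * E
  -- x`; this is the source of the 2 in `σ / (2 * C)`.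
  have hpow := (tendsto_E hxs hst hg).eventually
    (eventually_mul_rpow_lt (2 * C * (L + σ) * M / σ) hβ)
  refine ⟨σ / (2 * C), by positivity, ?_⟩
  filter_upwards [hw.eventually hmono, hw.eventually_mem (Metric.ball_mem_nhds xs hr),
    Metric.ball_mem_nhds xs hr, hEle, hpow, active_subset_eventually hxs]
    with x h1 h2 hx h3 h4 hact hfeas hslack
  rcases (P.E_nonneg x).eq_or_lt with h0 | h0
  · rw [← h0, mul_zero]; exact norm_nonneg _
  set q := x + w x - xs with hq
  have hqA : ∀ j ∈ P.active xs, P.mulA q j = t x j - (P.b j - P.mulA x j) := by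
    intro j hj
    have : P.mulA xs j = P.b j := hj
    rw [hq, mulA_sub, mulA_add, hAw x j hj, this]
    ring
  have hq1 : ∀ j ∈ P.activePlus xs, P.mulA q j = 0 := by
    intro j hj
    rw [hqA j hj.1]
    simp only [t, hj, if_true, sub_self]
  have hq2 : q ∈ P.nullSpace (P.active x) := by
    intro j hj
    have hj' : P.mulA x j = P.b j := hj
    by_cases hjp : j ∈ P.activePlus xs
    · exact hq1 j hjp
    · have hja : j ∈ P.active xs := by
        by_contra hc
        exact (hact j hc).ne hj'
      rw [hqA j hja, hj']
      simp only [t, hjp, if_false, sub_self]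
  have hwn : ‖w x‖ ≤ M * P.E x ^ β := by
    rw [hM, Finset.sum_mul]
    refine norm_sum_le_of_le _ fun i _ => ?_
    rw [norm_smul, mul_comm]
    refine mul_le_mul_of_nonneg_left ?_ (norm_nonneg _)
    by_cases hi : i ∈ P.activePlus xs
    · simp only [t, hi, if_true]
      rw [Real.norm_of_nonneg (sub_nonneg.2 (hfeas i))]
      exact hslack i hi
    · simp only [t, hi, if_false, norm_zero]
      exact (Real.rpow_pos_of_pos h0 β).le
  have h5 := h1 hq1
  have h6 : ‖P.g (x + w x) - P.g x‖ ≤ L * ‖w x‖ := by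
    simpa using hlip _ h2 x hx
  -- The direction `q` is annihilated by the strongly active rows, so `g xs` drops out, and by all
  -- rows active at `x`, so `g x` may be replaced by `gA x`.
  have h7 : ⟪P.g (x + w x) - P.g xs, q⟫ = ⟪P.g (x + w x) - P.g x, q⟫ + ⟪P.gA x, q⟫ := by
    rw [← inner_g_eq_inner_gA x hq2, inner_sub_left, inner_sub_left,
      hv.inner_g_eq_zero hxs hm hq1]
    ring
  have h8 := real_inner_le_norm (P.g (x + w x) - P.g x) q
  have h9 : ⟪P.gA x, q⟫ ≤ P.e x * ‖q‖ := real_inner_le_norm (P.gA x) q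
  have h10 : σ * ‖q‖ ≤ L * ‖w x‖ + P.e x := by
    rcases (norm_nonneg q).eq_or_lt with hq0 | hq0
    · rw [← hq0, mul_zero]
      exact add_nonneg (by positivity) (norm_nonneg _)
    · refine le_of_mul_le_mul_right ?_ hq0
      nlinarith [mul_le_mul_of_nonneg_right h6 hq0.le]
  have h11 : ‖x - xs‖ ≤ ‖q‖ + ‖w x‖ := by
    have : x - xs = q - w x := by rw [hq]; abel
    rw [this]
    exact norm_sub_le _ _
  replace h4 := h4 h0
  rw [Real.rpow_one] at h4
  have h12 : 2 * C * (L + σ) * M * P.E x ^ β < σ * P.E x := by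
    rw [div_mul_eq_mul_div, div_lt_iff₀ hσ] at h4
    linarith
  rw [div_mul_eq_mul_div, div_le_iff₀ (by positivity)]
  have h13 : P.E x ≤ C * (‖q‖ + ‖w x‖) := h3.trans (mul_le_mul_of_nonneg_left h11 hC.le)
  have h14 : σ * P.E x ≤ C * (P.e x + (L + σ) * ‖w x‖) := by
    calc σ * P.E x ≤ σ * (C * (‖q‖ + ‖w x‖)) := mul_le_mul_of_nonneg_left h13 hσ.le
      _ = C * (σ * ‖q‖ + σ * ‖w x‖) := by ring
      _ ≤ C * (L * ‖w x‖ + P.e x + σ * ‖w x‖) := by gcongr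
      _ = _ := by ring
  have h15 : C * (L + σ) * ‖w x‖ ≤ C * (L + σ) * (M * P.E x ^ β) :=
    mul_le_mul_of_nonneg_left hwn (by positivity)
  linarith

/-! ### Acceptance of the full step. -/

/-- Near `xs` the full projected gradient step passes the Armijo test when the slack of some strongly
active constraint is not negligible. -/
theorem IsDual.eventually_armijo (hv : P.IsDual xs v) (hxs : xs ∈ P.feasible)
    (hst : ∀ z ∈ P.feasible, 0 ≤ ⟪P.g xs, z - xs⟫) (hg : ContDiffAt ℝ 1 P.g xs)
    (hs : P.StrongSecondOrder xs) (hf : Differentiable ℝ P.f)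
    {α β δ : ℝ} (hα : 0 < α) (hβ : β < 2) (hδ : δ < 1) :
    ∀ᶠ x in 𝓝 xs, x ∈ P.feasible → 0 < P.E x →
      (∃ i ∈ P.activePlus xs, P.E x ^ β ≤ P.b i - P.mulA x i) →
      P.f (x + P.d x α) ≤ P.f x + δ * ⟪P.g x, P.d x α⟫ := by
  obtain ⟨L, hL, r, hr, hlip⟩ := exists_lipschitz_g hg
  obtain ⟨c, hc, herr⟩ := hv.exists_norm_sub_le_E hxs hst hg hs
  obtain ⟨C, hC, hyle⟩ := exists_norm_y_sub_le hxs hst hg hα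
  have hy := tendsto_y hxs hst hg hα
  -- The empty case is vacuous; in the other case a strongly active index brings a multiplier with
  -- it.
  rcases (P.activePlus xs).eq_empty_or_nonempty with hemp | ⟨i₀, hi₀⟩
  · refine Eventually.of_forall fun x _ _ h => ?_
    obtain ⟨i, hi, -⟩ := h
    rw [hemp] at hi
    exact hi.elim
  obtain ⟨-, lam, hlam, -⟩ := hi₀
  have hE := tendsto_E hxs hst hg
  set D := (C + 1) * c with hD
  -- The numerator collects the error of replacing `g x` by `g xs` and the Taylor remainder; the
  -- denominator is the coefficient of the decrease left over after the Armijo fraction `δ`.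
  have hpow : ∀ᶠ x in 𝓝 xs, ∀ i, 0 < P.E x →
      ((1 - δ) * L * c * D + L * D ^ 2) / ((1 - δ) * lam i) * P.E x ^ (2 : ℝ) < P.E x ^ β :=
    eventually_all.2 fun i => hE.eventually (eventually_mul_rpow_lt _ hβ)
  filter_upwards [hpow, herr, hyle, hv.eventually_activePlus_subset_y hxs hst hg hα,
    Metric.ball_mem_nhds xs hr, hy.eventually_mem (Metric.ball_mem_nhds xs hr)]
    with x h1 h2 h3 h4 hx hyx hfeas h0 hslack
  obtain ⟨i, hi, hsl⟩ := hslack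
  have hpos : 0 < lam i := (hv.activePlus_iff hxs hlam).1 hi
  have e1 : x + P.d x α = P.y x α := by rw [d]; abel
  have h5 := taylor_bound hf hL hlip hx hyx
  have e2 : P.y x α - x = P.d x α := rfl
  rw [e1]
  rw [e2] at h5
  have h6 : ‖P.d x α‖ ≤ D * P.E x := by
    have e3 : P.d x α = (P.y x α - xs) - (x - xs) := by rw [d]; abel
    rw [e3]
    refine (norm_sub_le _ _).trans ?_
    have := mul_le_mul_of_nonneg_left h2 (by positivity : 0 ≤ C + 1)
    rw [hD]
    linarith
  -- Strongly active constraints become active at `y x α`, so the step closes their slacks, and each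
  -- slack lowers the linear model in proportion to its multiplier.
  have h7 : ⟪P.g xs, P.d x α⟫ ≤ -(lam i * P.E x ^ β) := by
    rw [inner_g_eq_neg_sum hlam, neg_le_neg_iff]
    have hterm : ∀ j, lam j * P.mulA (P.d x α) j = lam j * (P.b j - P.mulA x j) := by
      intro j
      by_cases hj : j ∈ P.activePlus xs
      · have : P.mulA (P.y x α) j = P.b j := h4 hj
        rw [d, mulA_sub, this]
      · rw [hv.activePlus_iff hxs hlam, not_lt] at hj
        rw [le_antisymm hj (hlam.2.1 j), zero_mul, zero_mul]
    calc lam i * P.E x ^ β ≤ lam i * (P.b i - P.mulA x i) :=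
          mul_le_mul_of_nonneg_left hsl hpos.le
      _ ≤ ∑ j, lam j * (P.b j - P.mulA x j) :=
          Finset.single_le_sum (f := fun j => lam j * (P.b j - P.mulA x j))
            (fun j _ => mul_nonneg (hlam.2.1 j) (sub_nonneg.2 (hfeas j))) (Finset.mem_univ i)
      _ = _ := Finset.sum_congr rfl fun j _ => (hterm j).symm
  have h8 : ⟪P.g x - P.g xs, P.d x α⟫ ≤ L * c * D * P.E x ^ 2 := by
    refine (real_inner_le_norm _ _).trans ?_
    have h9 : ‖P.g x - P.g xs‖ ≤ L * (c * P.E x) :=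
      (hlip x hx xs (Metric.mem_ball_self hr)).trans (mul_le_mul_of_nonneg_left h2 hL.le)
    calc _ ≤ L * (c * P.E x) * (D * P.E x) :=
          mul_le_mul h9 h6 (norm_nonneg _) (by positivity)
      _ = _ := by ring
  have h10 : ‖P.d x α‖ ^ 2 ≤ D ^ 2 * P.E x ^ 2 := by
    rw [← mul_pow]
    exact pow_le_pow_left₀ (norm_nonneg _) h6 2
  have h11 := h1 i h0
  rw [div_mul_eq_mul_div, div_lt_iff₀ (mul_pos (sub_pos.2 hδ) hpos), Real.rpow_two] at h11
  have h12 : ⟪P.g x, P.d x α⟫ ≤ L * c * D * P.E x ^ 2 - lam i * P.E x ^ β := by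
    rw [inner_sub_left] at h8
    linarith
  have h13 := mul_le_mul_of_nonneg_left h12 (sub_pos.2 hδ).le
  have h14 := mul_le_mul_of_nonneg_left h10 hL.le
  linarith

end Problem

/-! ### Single iterations and runs of the algorithm. -/

variable {m n : ℕ} {P : Problem m n} {par : Params}

/-- The new point lies on the line through `x` and `y x par.α`, and equality constraints are affine.
-/
theorem active_subset_gpaStep {x x' : EuclideanSpace ℝ (Fin n)} (h : GPAStep P par x x')
    {I : Set (Fin m)} (hx : I ⊆ P.active x) (hy : I ⊆ P.active (P.y x par.α)) :
    I ⊆ P.active x' := by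
  obtain ⟨j, -, rfl⟩ := h
  intro i hi
  have h1 : P.mulA x i = P.b i := hx hi
  have h2 : P.mulA (P.y x par.α) i = P.b i := hy hi
  change P.mulA _ i = P.b i
  rw [Problem.mulA_add, Problem.mulA_smul, Problem.d, Problem.mulA_sub, h1, h2]
  ring

theorem gpaStep_feasible {x x' : EuclideanSpace ℝ (Fin n)} (h : GPAStep P par x x')
    (hx : x ∈ P.feasible) : x' ∈ P.feasible := by
  obtain ⟨j, -, rfl⟩ := h
  have hj : par.η ^ j ∈ Set.Icc (0 : ℝ) 1 :=
    ⟨(pow_pos par.η_mem.1 j).le, pow_le_one₀ par.η_mem.1.le par.η_mem.2.le⟩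
  exact P.convex_feasible.add_smul_sub_mem hx (P.y_mem ⟨x, hx⟩ x par.α) hj

theorem startStep_mem_face {x x' : EuclideanSpace ℝ (Fin n)} (h : StartStep P par x x')
    (hx : x ∈ P.feasible) : x' ∈ P.face x := by
  obtain ⟨j, -, rfl⟩ := h
  exact (metricProj_spec ⟨x, P.self_mem_face hx⟩ (P.isClosed_face x) _).1

theorem Step.feasible {lam : Fin m → ℝ} {s s' : State n} (h : Step P par lam s s')
    (hx : s.x ∈ P.feasible) : s'.x ∈ P.feasible := by
  cases h with
  | gpa x' h1 h2 h3 => exact gpaStep_feasible h3 hx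
  | branch x' h1 h2 h3 => exact (startStep_mem_face h3 hx).1
  | lco x' h1 h2 => exact h2.2.1

/-- One iteration keeps those active constraints that are active at the projected gradient point. -/
theorem Step.active_subset {lam : Fin m → ℝ} {s s' : State n} (h : Step P par lam s s')
    (hx : s.x ∈ P.feasible) {I : Set (Fin m)} (hI : I ⊆ P.active s.x)
    (hy : I ⊆ P.active (P.y s.x par.α)) : I ⊆ P.active s'.x := by
  cases h with
  | gpa x' h1 h2 h3 => exact active_subset_gpaStep h3 hI hy
  | branch x' h1 h2 h3 => exact fun i hi => (startStep_mem_face h3 hx).2 i (hI hi)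
  | lco x' h1 h2 => exact hI.trans h2.2.2.2

theorem updatedTheta_pos_le {lam : Fin m → ℝ} {s : State n} (hs : 0 < s.θ) :
    0 < s.updatedTheta P par lam ∧ s.updatedTheta P par lam ≤ s.θ := by
  unfold State.updatedTheta
  split_ifs
  · exact ⟨mul_pos par.μ_mem.1 hs, mul_le_of_le_one_left hs.le par.μ_mem.2.le⟩
  · exact ⟨hs, le_rfl⟩

theorem Step.theta_pos_le {lam : Fin m → ℝ} {s s' : State n} (h : Step P par lam s s')
    (hs : 0 < s.θ) : 0 < s'.θ ∧ s'.θ ≤ s.θ := by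
  cases h with
  | gpa x' h1 h2 h3 => exact updatedTheta_pos_le hs
  | branch x' h1 h2 h3 => exact updatedTheta_pos_le hs
  | lco x' h1 h2 => exact ⟨hs, le_rfl⟩

/-- If the test for phase one succeeds and the undecided index set is empty, then `θ` is reduced. -/
theorem Step.theta_eq {lam : Fin m → ℝ} {s s' : State n} (h : Step P par lam s s')
    (ht : P.e s.x < s.θ * P.E s.x) (hU : undecided P par s.x lam = ∅) :
    s'.θ = par.μ * s.θ := by
  have hu : s.updatedTheta P par lam = par.μ * s.θ := if_pos ⟨hU, ht⟩
  cases h with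
  | gpa x' h1 h2 h3 => exact hu
  | branch x' h1 h2 h3 => exact hu
  | lco x' h1 h2 => exact absurd (Or.inr ht) h1

/-- If the test for phase one succeeds and the undecided index set is nonempty, then a gradient
projection step is taken. -/
theorem Step.gpaStep {lam : Fin m → ℝ} {s s' : State n} (h : Step P par lam s s')
    (ht : P.e s.x < s.θ * P.E s.x) (hU : undecided P par s.x lam ≠ ∅) :
    GPAStep P par s.x s'.x := by
  have hu : s.updatedTheta P par lam = s.θ := if_neg fun hc => hU hc.1
  cases h with
  | gpa x' h1 h2 h3 => exact h3
  | branch x' h1 h2 h3 => exact absurd ht (not_lt.2 (hu ▸ h2))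
  | lco x' h1 h2 => exact absurd (Or.inr ht) h1

/-- A step from an iterate that does not pass the test for phase one ends in phase two. -/
theorem Step.phase_eq_two {lam : Fin m → ℝ} {s s' : State n} (h : Step P par lam s s')
    (ht : ¬ P.e s.x < s.θ * P.E s.x) : s'.phase = Phase.two := by
  have hu : s.updatedTheta P par lam = s.θ := if_neg fun hc => ht hc.2
  cases h with
  | gpa x' h1 h2 h3 => exact absurd (hu ▸ h2) ht
  | branch x' h1 h2 h3 => rfl
  | lco x' h1 h2 => rfl

/-- If the Armijo test holds for the full step, then the gradient projection step ends at the
projected gradient point. -/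
theorem GPAStep.eq_y {x x' : EuclideanSpace ℝ (Fin n)} (h : GPAStep P par x x')
    (ha : P.f (x + P.d x par.α) ≤ P.f x + par.δ * ⟪P.g x, P.d x par.α⟫) :
    x' = P.y x par.α := by
  obtain ⟨j, hj, rfl⟩ := h
  have h0 : j = 0 := Nat.le_zero.1 (hj.2 (by simpa using ha))
  rw [h0, pow_zero, one_smul, Problem.d, add_sub_cancel]

theorem IsInfiniteRun.feasible {ε : ℝ} {x₀ : EuclideanSpace ℝ (Fin n)} {s : ℕ → State n}
    (hrun : IsInfiniteRun P par ε x₀ s) (hne : P.feasible.Nonempty) :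
    ∀ k ≥ 1, (s k).x ∈ P.feasible := by
  intro k hk
  induction k, hk using Nat.le_induction with
  | base =>
    rw [hrun.start]
    exact (metricProj_spec hne P.isClosed_feasible x₀).1
  | succ k hk ih =>
    obtain ⟨lam, -, h⟩ := hrun.step k hk
    exact h.feasible ih

theorem IsInfiniteRun.theta_pos {ε : ℝ} {x₀ : EuclideanSpace ℝ (Fin n)} {s : ℕ → State n}
    (hrun : IsInfiniteRun P par ε x₀ s) : ∀ k ≥ 1, 0 < (s k).θ := by
  intro k hk
  induction k, hk using Nat.le_induction with
  | base =>
    rw [hrun.start]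
    exact par.θ₁_mem.1
  | succ k hk ih =>
    obtain ⟨lam, -, h⟩ := hrun.step k hk
    exact (h.theta_pos_le ih).1

/-- A positive sequence that is eventually nonincreasing cannot be multiplied infinitely often by a
constant below one while staying above a positive bound. -/
theorem not_frequently_of_antitone {θ : ℕ → ℝ} {K : ℕ} {c μ : ℝ} (hc : 0 < c) (hμ : μ < 1)
    (hpos : ∀ k ≥ K, 0 ≤ θ k) (hle : ∀ k ≥ K, θ (k + 1) ≤ θ k) :
    ¬ ∃ᶠ k in atTop, θ (k + 1) = μ * θ k ∧ c ≤ θ k := by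
  intro hfr
  have hanti : Antitone fun k => θ (k + K) := antitone_nat_of_succ_le fun k => by
    have := hle (k + K) (by omega)
    rwa [show k + K + 1 = k + 1 + K by ring] at this
  have hbdd : BddBelow (Set.range fun k => θ (k + K)) :=
    ⟨0, by rintro _ ⟨k, rfl⟩; exact hpos _ (by omega)⟩
  have hlim := (tendsto_add_atTop_iff_nat K).1 (tendsto_atTop_ciInf hanti hbdd)
  have hlim' := (tendsto_add_atTop_iff_nat 1).2 hlim
  set l := ⨅ k, θ (k + K)
  -- The limit `l` would satisfy both `c ≤ l` and `l ≤ μ * l`, which is impossible for `c > 0` and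
  -- `μ < 1`.
  have h1 : c ≤ l := ge_of_tendsto_of_frequently hlim (hfr.mono fun k hk => hk.2)
  have h2 : l - μ * l ≤ 0 := le_of_tendsto_of_frequently (hlim'.sub (hlim.const_mul μ))
    (hfr.mono fun k hk => (sub_eq_zero.2 hk.1).le)
  nlinarith

end PASA

/-! ### Finite identification and the end of phase one. -/

theorem theorem6p7 {m n : ℕ} (P : PASA.Problem m n) (par : PASA.Params)
    (hf : ContDiff ℝ 1 P.f)
    (x₀ : EuclideanSpace ℝ (Fin n)) (s : ℕ → PASA.State n)
    (hrun : PASA.IsInfiniteRun P par 0 x₀ s)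
    (xstar : EuclideanSpace ℝ (Fin n))
    (hconv : Filter.Tendsto (fun k => (s k).x) Filter.atTop (nhds xstar))
    (hfeas : xstar ∈ P.feasible)
    (hmin : IsLocalMinOn P.f P.feasible xstar)
    (hli : P.LinIndepActive xstar)
    (hssoc : P.StrongSecondOrder xstar)
    (hC2 : ∃ r : ℝ, 0 < r ∧ ContDiffOn ℝ 2 P.f (Metric.ball xstar r)) :
    ∃ K : ℕ, ∀ k ≥ K, ¬ (s k).ExecutesPhaseOne P := by
  have hdiff : Differentiable ℝ P.f := hf.differentiable one_ne_zero
  obtain ⟨r, hr, hC2⟩ := hC2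
  have hg := PASA.Problem.contDiffAt_g (hC2.contDiffAt (Metric.ball_mem_nhds xstar hr))
  have hst := PASA.Problem.inner_nonneg_of_isLocalMinOn (hdiff xstar) hfeas hmin
  obtain ⟨v, hv⟩ := hli.exists_dual
  replace hv : P.IsDual xstar v := hv
  have hge : ∀ᶠ k : ℕ in atTop, 1 ≤ k := eventually_ge_atTop 1
  have hm : (P.multipliers xstar).Nonempty := by
    refine hv.multipliers_nonempty hfeas hst hg (hconv.frequently ?_)
    refine (hge.mono fun k hk => ?_).frequently
    obtain ⟨lam, hlam, -⟩ := hrun.step k hk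
    exact ⟨lam, hlam⟩
  obtain ⟨c, hc, hcE⟩ := hv.exists_mul_E_le_e hfeas hst hg hssoc hm par.β_mem.1
  have hlate := (hconv.eventually hcE).and <| (hconv.eventually
    (hv.eventually_projMultiplier_lt hfeas hst hg hssoc hm par.γ_mem.2)).and <|
    (hconv.eventually (hv.eventually_le_projMultiplier hfeas hst hg par.γ_mem.1)).and <|
    (hconv.eventually (hv.eventually_armijo hfeas hst hg hssoc hdiff par.α_pos par.β_mem.2
      par.δ_mem.2)).and <|
    (hconv.eventually (hv.eventually_activePlus_subset_y hfeas hst hg par.α_pos)).and hge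
  obtain ⟨K, hK⟩ := eventually_atTop.1 hlate
  have hU_plus : ∀ k ≥ K, ∀ lam ∈ P.projMultipliers (s k).x 1,
      ∀ i ∈ PASA.undecided P par (s k).x lam, i ∈ P.activePlus xstar := by
    intro k hk lam hlam i hi
    obtain ⟨-, h, -, -, -, h1⟩ := hK k hk
    by_contra hc
    exact (h (hrun.not_stopped k h1) lam hlam i hc).not_ge hi.1
  have hpersist : ∀ k ≥ K, P.activePlus xstar ⊆ P.active (s k).x →
      P.activePlus xstar ⊆ P.active (s (k + 1)).x := by
    intro k hk hsub
    obtain ⟨-, -, -, -, hy, h1⟩ := hK k hk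
    obtain ⟨lam, -, h⟩ := hrun.step k h1
    exact h.active_subset (hrun.feasible ⟨xstar, hfeas⟩ k h1) hsub hy
  have hU_empty : ∀ k ≥ K, P.activePlus xstar ⊆ P.active (s k).x →
      ∀ lam ∈ P.projMultipliers (s k).x 1, PASA.undecided P par (s k).x lam = ∅ := by
    intro k hk hsub lam hlam
    refine Set.eq_empty_of_forall_notMem fun i hi => ?_
    have h1 : P.mulA (s k).x i = P.b i := hsub (hU_plus k hk lam hlam i hi)
    have h2 := hi.2
    rw [h1, sub_self] at h2
    exact h2.not_gt (Real.rpow_pos_of_pos (hrun.not_stopped k (hK k hk).2.2.2.2.2) _)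
  have hidentify : ∀ k ≥ K, ∀ lam ∈ P.projMultipliers (s k).x 1,
      PASA.Step P par lam (s k) (s (k + 1)) → P.e (s k).x < (s k).θ * P.E (s k).x →
      PASA.undecided P par (s k).x lam ≠ ∅ → P.activePlus xstar ⊆ P.active (s (k + 1)).x := by
    intro k hk lam hlam hstep ht hU
    obtain ⟨-, -, -, ha, hy, h1⟩ := hK k hk
    obtain ⟨i, hi⟩ := Set.nonempty_iff_ne_empty.2 hU
    rw [(hstep.gpaStep ht hU).eq_y (ha (hrun.feasible ⟨xstar, hfeas⟩ k h1)
      (hrun.not_stopped k h1) ⟨i, hU_plus k hk lam hlam i hi, hi.2⟩)]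
    exact hy
  have hreduce : ∀ k ≥ K, ∀ lam ∈ P.projMultipliers (s k).x 1,
      PASA.Step P par lam (s k) (s (k + 1)) → P.e (s k).x < (s k).θ * P.E (s k).x →
      PASA.undecided P par (s k).x lam = ∅ → (s (k + 1)).θ = par.μ * (s k).θ ∧ c ≤ (s k).θ := by
    intro k hk lam hlam hstep ht hU
    obtain ⟨he, -, hlarge, -, -, h1⟩ := hK k hk
    refine ⟨hstep.theta_eq ht hU, ?_⟩
    -- Strongly active indices already pass the multiplier test, so emptiness of the undecided set
    -- can only come from small slacks.
    have h2 := he (hrun.feasible ⟨xstar, hfeas⟩ k h1) fun i hi => by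
      by_contra hlt
      have : i ∈ PASA.undecided P par (s k).x lam := ⟨hlarge lam hlam i hi, (not_le.1 hlt).le⟩
      rw [hU] at this
      exact this
    exact (lt_of_mul_lt_mul_right (h2.trans_lt ht) (PASA.Problem.E_nonneg _)).le
  have hK1 : 1 ≤ K := (hK K le_rfl).2.2.2.2.2
  have htest : ∀ᶠ k in atTop, ¬ P.e (s k).x < (s k).θ * P.E (s k).x := by
    by_contra hfr
    rw [not_eventually] at hfr
    simp only [not_not] at hfr
    refine PASA.not_frequently_of_antitone (K := K) hc par.μ_mem.2
      (fun k hk => (hrun.theta_pos k (hK1.trans hk)).le) (fun k hk => ?_) ?_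
    · obtain ⟨lam, -, h⟩ := hrun.step k (hK1.trans hk)
      exact (h.theta_pos_le (hrun.theta_pos k (hK1.trans hk))).2
    · by_cases hid : ∃ k₀ ≥ K, P.activePlus xstar ⊆ P.active (s k₀).x
      · obtain ⟨k₀, hk₀, hsub⟩ := hid
        refine (hfr.and_eventually (eventually_ge_atTop k₀)).mono ?_
        rintro k ⟨ht, hk⟩
        have hsubk : P.activePlus xstar ⊆ P.active (s k).x := by
          clear ht
          induction k, hk using Nat.le_induction with
          | base => exact hsub
          | succ j hj ih => exact hpersist j (hk₀.trans hj) ih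
        have hkK := hk₀.trans hk
        obtain ⟨lam, hlam, h⟩ := hrun.step k (hK1.trans hkK)
        exact hreduce k hkK lam hlam h ht (hU_empty k hkK hsubk lam hlam)
      · refine (hfr.and_eventually (eventually_ge_atTop K)).mono ?_
        rintro k ⟨ht, hk⟩
        obtain ⟨lam, hlam, h⟩ := hrun.step k (hK1.trans hk)
        refine hreduce k hk lam hlam h ht ?_
        by_contra hU
        exact hid ⟨k + 1, hk.trans k.le_succ, hidentify k hk lam hlam h ht hU⟩
  obtain ⟨N, hN⟩ := eventually_atTop.1 htest
  -- The predecessor of `k` must lie beyond `N`, where the test fails, and must be at least 1, since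
  -- the run starts at index 1.
  refine ⟨N + 2, fun k hk hex => ?_⟩
  rcases hex with h1 | h1
  · obtain ⟨j, rfl⟩ : ∃ j, k = j + 1 := ⟨k - 1, by omega⟩
    obtain ⟨lam, -, h⟩ := hrun.step j (by omega)
    rw [h.phase_eq_two (hN j (by omega))] at h1
    cases h1
  · exact hN k (by omega) h1
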